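/- Let $\omega(x,y)=8-2\cos x-2\cos y-2\cos(x+y)-2\cos(x-y)$ for $(x,y)\in\mathbb{R}^2$. For $k\ge 1$, a smooth function $f:\mathbb{R}^2\to\mathbb{R}$ is said to have a singularity of type $A_k$ at a point $p$ if there are $C^\infty$ local coordinates $(u,v)$ defined on an open neighbourhood of $p$ and centred at $p$ (that is, $q\mapsto(u(q),v(q))$ is a $C^\infty$ diffeomorphism of that neighbourhood onto an open neighbourhood of the origin in $\mathbb{R}^2$, sending $p$ to the origin), and signs $\varepsilon_1,\varepsilon_2\in\{1,-1\}$, such that $f=f(p)+\varepsilon_1u^{k+1}+\varepsilon_2v^2$ on that neighbourhood. Then for every $(x_0,y_0)\in[0,2\pi]^2$ there is $k\in\{1,2,3\}$ such that the function $$(x,y)\mapsto\omega(x,y)-(x,y)\cdot\nabla\omega(x_0,y_0)$$ on $\mathbb{R}^2$ has a singularity of type $A_k$ at $(x_0,y_0)$. -/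

import Mathlib

/-- The Euclidean plane; the coordinates of `q` are `q 0` and `q 1`. -/
abbrev Plane : Type := EuclideanSpace ℝ (Fin 2)

/-- The dispersion relation
`ω(x, y) = 8 - 2 cos x - 2 cos y - 2 cos (x + y) - 2 cos (x - y)`. -/
noncomputable def omega (q : Plane) : ℝ :=
  8 - 2 * Real.cos (q 0) - 2 * Real.cos (q 1)
    - 2 * Real.cos (q 0 + q 1) - 2 * Real.cos (q 0 - q 1)

/-- The phase `q ↦ ω(q) - q · ∇ω(p)`, for which `p` is a critical point. -/
noncomputable def phase (p q : Plane) : ℝ :=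
  omega q - inner ℝ q (gradient omega p)

/-- A smooth local coordinate system centred at `p`: a diffeomorphism of class `C^∞` (with
inverse of class `C^∞`) from an open neighbourhood of `p` onto an open neighbourhood of the
origin, sending `p` to the origin. -/
structure IsSmoothChartAt (Φ : OpenPartialHomeomorph Plane Plane) (p : Plane) : Prop where
  mem_source : p ∈ Φ.source
  map_center : Φ p = 0
  contDiffOn_toFun : ContDiffOn ℝ (⊤ : ℕ∞) Φ Φ.source
  contDiffOn_symm : ContDiffOn ℝ (⊤ : ℕ∞) Φ.symm Φ.target

/-- `f` has at `p` a singularity of type `A_k` (for `k ≥ 1`): in suitable smooth local coordinates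
`(u, v)` centred at `p` the function has the real normal form `f = f(p) ± u ^ (k + 1) ± v ^ 2`
near `p`. -/
def HasTypeA (k : ℕ) (f : Plane → ℝ) (p : Plane) : Prop :=
  ∃ Φ : OpenPartialHomeomorph Plane Plane, IsSmoothChartAt Φ p ∧
    ∃ ε₁ ε₂ : ℝ, (ε₁ = 1 ∨ ε₁ = -1) ∧ (ε₂ = 1 ∨ ε₂ = -1) ∧
      ∀ q ∈ Φ.source, f q = f p + ε₁ * (Φ q 0) ^ (k + 1) + ε₂ * (Φ q 1) ^ 2

/-! With a = cos x and b = cos y, the phase is 8 - 2a - 2b - 4ab minus a linear form, and its second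
x-derivative is 2a(1 + 2b). Where this is nonzero, the x-derivative vanishes along an analytic curve
x = φ(y) (`exists_critical_curve`), and the phase splits as h(y) plus a unit times (x - φ(y))², with
h its restriction to the curve. Here h'' is the Hessian determinant divided by the second
x-derivative.

The theorem thus rests on bounding the order of that determinant along the curve. Its derivative
there is sin y times a factor that is nonzero at any zero of the determinant
(`hessianKernelDeriv_ne_zero`). Zeros of the sine are simple, so the determinant has order at most 2
and h - h(y₀) has order 2, 3 or 4, which gives A₁, A₂ or A₃.

By symmetry x and y may be exchanged. The points left over have both cosines equal to 0 or both
equal to -1/2; there the Hessian has zero diagonal and nonzero mixed entry, a saddle of type A₁. -/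

open Filter Topology
open scoped ContDiff

/-! ### Analytic normal forms and smooth charts -/

/-- `f` has at `p` the real normal form of type `A_k` in analytic coordinates `(U, V)`. -/
def HasNormalFormA (k : ℕ) (f : ℝ × ℝ → ℝ) (p : ℝ × ℝ) : Prop :=
  ∃ U V : ℝ × ℝ → ℝ, ContDiffAt ℝ ω U p ∧ ContDiffAt ℝ ω V p ∧ U p = 0 ∧ V p = 0 ∧
    (∀ w, fderiv ℝ U p w = 0 → fderiv ℝ V p w = 0 → w = 0) ∧
    ∃ ε₁ ε₂ : ℝ, (ε₁ = 1 ∨ ε₁ = -1) ∧ (ε₂ = 1 ∨ ε₂ = -1) ∧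
      ∀ᶠ z in 𝓝 p, f z = f p + ε₁ * U z ^ (k + 1) + ε₂ * V z ^ 2

theorem HasNormalFormA.swap {k : ℕ} {f : ℝ × ℝ → ℝ} {p : ℝ × ℝ}
    (h : HasNormalFormA k f p) : HasNormalFormA k (f ∘ Prod.swap) p.swap := by
  obtain ⟨U, V, hU, hV, hU0, hV0, hind, ε₁, ε₂, h1, h2, he⟩ := h
  have hs : ∀ x : ℝ × ℝ, HasFDerivAt (Prod.swap : ℝ × ℝ → ℝ × ℝ)
      (ContinuousLinearEquiv.prodComm ℝ ℝ ℝ : ℝ × ℝ →L[ℝ] ℝ × ℝ) x :=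
    fun x => (ContinuousLinearEquiv.prodComm ℝ ℝ ℝ).hasFDerivAt
  have hsw : ContDiffAt ℝ ω (Prod.swap : ℝ × ℝ → ℝ × ℝ) p.swap :=
    (ContinuousLinearEquiv.prodComm ℝ ℝ ℝ).contDiff.contDiffAt
  have hd : ∀ W : ℝ × ℝ → ℝ, ContDiffAt ℝ ω W p → ∀ w,
      fderiv ℝ (W ∘ Prod.swap) p.swap w = fderiv ℝ W p w.swap := by
    intro W hW w
    have h' : HasFDerivAt W (fderiv ℝ W p) p.swap.swap := by
      simpa using (hW.differentiableAt (by simp)).hasFDerivAt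
    rw [(h'.comp p.swap (hs _)).fderiv]
    rfl
  refine ⟨U ∘ Prod.swap, V ∘ Prod.swap, ContDiffAt.comp _ (by simpa using hU) hsw,
    ContDiffAt.comp _ (by simpa using hV) hsw, by simpa using hU0, by simpa using hV0, ?_,
    ε₁, ε₂, h1, h2, ?_⟩
  · intro w hw1 hw2
    rw [hd U hU] at hw1
    rw [hd V hV] at hw2
    have := hind _ hw1 hw2
    simpa using congrArg Prod.swap this
  · have hc : Tendsto (Prod.swap : ℝ × ℝ → ℝ × ℝ) (𝓝 p.swap) (𝓝 p) := by
      simpa using continuous_swap.tendsto p.swap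
    simpa using hc.eventually he

/-- By the inverse function theorem, an analytic normal form gives a smooth chart. -/
theorem HasNormalFormA.hasTypeA {k : ℕ} {f : ℝ × ℝ → ℝ} {p : Plane}
    (h : HasNormalFormA k f (p 0, p 1)) : HasTypeA k (fun q => f (q 0, q 1)) p := by
  obtain ⟨U, V, hU, hV, hU0, hV0, hind, ε₁, ε₂, h1, h2, he⟩ := h
  set π : Plane →L[ℝ] ℝ × ℝ := (EuclideanSpace.proj 0).prod (EuclideanSpace.proj 1) with hπ
  have hπ_apply : ∀ q : Plane, π q = (q 0, q 1) := fun q => rfl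
  set e := (EuclideanSpace.equiv (Fin 2) ℝ).symm
  set Ψ : Plane → Plane := fun q => e ![U (π q), V (π q)] with hΨ
  have hΨ0 : ∀ q, Ψ q 0 = U (π q) := fun q => rfl
  have hΨ1 : ∀ q, Ψ q 1 = V (π q) := fun q => rfl
  have hUc : ContDiffAt ℝ ω (fun q => U (π q)) p :=
    ContDiffAt.comp p (g := U) hU π.contDiff.contDiffAt
  have hVc : ContDiffAt ℝ ω (fun q => V (π q)) p :=
    ContDiffAt.comp p (g := V) hV π.contDiff.contDiffAt
  have hΨc : ContDiffAt ℝ ω Ψ p := by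
    refine e.contDiff.contDiffAt.comp p (contDiffAt_pi.2 fun i => ?_)
    fin_cases i
    · exact hUc
    · exact hVc
  have hΨd : HasFDerivAt Ψ (fderiv ℝ Ψ p) p := (hΨc.differentiableAt (by simp)).hasFDerivAt
  have hcomp : ∀ W : ℝ × ℝ → ℝ, ContDiffAt ℝ ω W (p 0, p 1) → ∀ i : Fin 2,
      (∀ q, Ψ q i = W (π q)) → ∀ w, fderiv ℝ Ψ p w i = fderiv ℝ W (p 0, p 1) (π w) := by
    intro W hW i hi w
    have ha : HasFDerivAt (fun q => Ψ q i)
        ((EuclideanSpace.proj i : Plane →L[ℝ] ℝ).comp (fderiv ℝ Ψ p)) p :=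
      (EuclideanSpace.proj i : Plane →L[ℝ] ℝ).hasFDerivAt.comp p hΨd
    have hb : HasFDerivAt (fun q => W (π q)) ((fderiv ℝ W (p 0, p 1)).comp π) p :=
      HasFDerivAt.comp p (g := W) (hW.differentiableAt (by simp)).hasFDerivAt π.hasFDerivAt
    have hab : (fun q => Ψ q i) = fun q => W (π q) := funext hi
    rw [hab] at ha
    exact congrArg (fun T : Plane →L[ℝ] ℝ => T w) (ha.unique hb)
  have hinj : Function.Injective (fderiv ℝ Ψ p : Plane →ₗ[ℝ] Plane) := by
    rw [← LinearMap.ker_eq_bot, LinearMap.ker_eq_bot']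
    intro w hw
    have hw' : fderiv ℝ Ψ p w = 0 := hw
    have hz := hind (π w) (by rw [← hcomp U hU 0 hΨ0, hw']; rfl)
      (by rw [← hcomp V hV 1 hΨ1, hw']; rfl)
    rw [hπ_apply, Prod.mk_eq_zero] at hz
    ext i
    fin_cases i
    · exact hz.1
    · exact hz.2
  set T : Plane ≃L[ℝ] Plane :=
    (LinearEquiv.ofInjectiveEndo _ hinj).toContinuousLinearEquiv with hT
  have hTd : HasFDerivAt Ψ (T : Plane →L[ℝ] Plane) p := by
    have : (T : Plane →L[ℝ] Plane) = fderiv ℝ Ψ p := by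
      ext1 w
      rfl
    rw [this]
    exact hΨd
  set Φ := hΨc.toOpenPartialHomeomorph Ψ hTd (by simp) with hΦ
  have hΦΨ : (Φ : Plane → Plane) = Ψ := rfl
  have hp : p ∈ Φ.source := hΨc.mem_toOpenPartialHomeomorph_source hTd (by simp)
  have hsymm : ContDiffAt ℝ ω Φ.symm (Φ p) := by
    apply Φ.contDiffAt_symm (Φ.map_source hp) (f₀' := T)
    · rw [Φ.left_inv hp]
      exact hTd
    · rw [Φ.left_inv hp]
      exact hΨc
  -- Analyticity is known only at the base point, so the chart is shrunk to where it and its inverse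
  -- are analytic, then to an open set on which the normal form identity holds.
  set Φ₁ := Φ.restrContDiff ℝ ω (by simp)
  have hΦ₁ : (Φ₁ : Plane → Plane) = Ψ := rfl
  have hp₁ : p ∈ Φ₁.source := ⟨hp, hΨc, hsymm⟩
  obtain ⟨S, hS, hSo, hpS⟩ := eventually_nhds_iff.1
    ((π.continuous.tendsto p).eventually he)
  set Φ₂ := Φ₁.restrOpen S hSo
  have hsrc : Φ₂.source = Φ₁.source ∩ S := rfl
  refine ⟨Φ₂, ⟨⟨hp₁, hpS⟩, ?_, ?_, ?_⟩, ε₁, ε₂, h1, h2, ?_⟩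
  · change Ψ p = 0
    ext i
    fin_cases i
    · exact hU0
    · exact hV0
  · exact ((Φ.contDiffOn_restrContDiff_source (𝕜 := ℝ) (n := ω) (by simp)).of_le le_top).mono
      (fun q hq => hq.1)
  · exact ((Φ.contDiffOn_restrContDiff_target (𝕜 := ℝ) (n := ω) (by simp)).of_le le_top).mono
      (fun q hq => hq.1)
  · intro q hq
    exact hS q hq.2

/-- A unit factor can be absorbed into a power, up to a sign. -/
theorem exists_pow_eq_pow_mul {E : Type*} [NormedAddCommGroup E] [NormedSpace ℝ E]
    {g r : E → ℝ} {p : E} (hg : ContDiffAt ℝ ω g p) (hg0 : g p = 0)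
    (hr : ContDiffAt ℝ ω r p) (hr0 : r p ≠ 0) {n : ℕ} (hn : n ≠ 0) :
    ∃ U : E → ℝ, ContDiffAt ℝ ω U p ∧ U p = 0 ∧
      (∃ c : ℝ, c ≠ 0 ∧ fderiv ℝ U p = c • fderiv ℝ g p) ∧
      ∃ ε : ℝ, (ε = 1 ∨ ε = -1) ∧ ∀ᶠ q in 𝓝 p, g q ^ n * r q = ε * U q ^ n := by
  obtain ⟨ε, hε, hpos⟩ : ∃ ε : ℝ, (ε = 1 ∨ ε = -1) ∧ 0 < ε * r p := by
    rcases lt_or_gt_of_ne hr0 with h | h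
    · exact ⟨-1, Or.inr rfl, by linarith⟩
    · exact ⟨1, Or.inl rfl, by linarith⟩
  have hεε : ε * ε = 1 := by rcases hε with rfl | rfl <;> norm_num
  set s : E → ℝ := fun q => (ε * r q) ^ (1 / (n : ℝ)) with hs
  have hεr : ContDiffAt ℝ ω (fun q => ε * r q) p := contDiffAt_const.mul hr
  have hsc : ContDiffAt ℝ ω s p := hεr.rpow_const_of_ne hpos.ne'
  have hspos : 0 < s p := Real.rpow_pos_of_pos hpos _
  refine ⟨fun q => g q * s q, hg.mul hsc, by simp [hg0], ⟨s p, hspos.ne', ?_⟩, ε, hε, ?_⟩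
  -- As `g` vanishes at `p`, the term containing the derivative of `s` drops out.
  · have := ((hg.differentiableAt (by simp)).hasFDerivAt.mul
      (hsc.differentiableAt (by simp)).hasFDerivAt).fderiv
    rw [hg0, zero_smul, zero_add] at this
    exact this
  · filter_upwards [hεr.continuousAt.eventually (lt_mem_nhds hpos)] with q hq
    have : s q ^ n = ε * r q := by
      rw [hs, one_div]
      exact Real.rpow_inv_natCast_pow hq.le hn
    rw [mul_pow, this]
    linear_combination (-(g q ^ n * r q)) * hεε

/-- Splitting into powers with unit coefficients yields a normal form. -/
theorem HasNormalFormA.of_unit_coefficients {k : ℕ} {f g₁ g₂ r₁ r₂ : ℝ × ℝ → ℝ} {p : ℝ × ℝ}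
    (hg₁ : ContDiffAt ℝ ω g₁ p) (hg₂ : ContDiffAt ℝ ω g₂ p)
    (hr₁ : ContDiffAt ℝ ω r₁ p) (hr₂ : ContDiffAt ℝ ω r₂ p)
    (h₁ : g₁ p = 0) (h₂ : g₂ p = 0) (hr₁' : r₁ p ≠ 0) (hr₂' : r₂ p ≠ 0)
    (hind : ∀ w, fderiv ℝ g₁ p w = 0 → fderiv ℝ g₂ p w = 0 → w = 0)
    (he : ∀ᶠ z in 𝓝 p, f z = f p + g₁ z ^ (k + 1) * r₁ z + g₂ z ^ 2 * r₂ z) :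
    HasNormalFormA k f p := by
  obtain ⟨U, hU, hU0, ⟨c, hc, hUd⟩, ε₁, hε₁, hUe⟩ :=
    exists_pow_eq_pow_mul hg₁ h₁ hr₁ hr₁' (Nat.succ_ne_zero k)
  obtain ⟨V, hV, hV0, ⟨d, hd, hVd⟩, ε₂, hε₂, hVe⟩ :=
    exists_pow_eq_pow_mul hg₂ h₂ hr₂ hr₂' two_ne_zero
  refine ⟨U, V, hU, hV, hU0, hV0, ?_, ε₁, ε₂, hε₁, hε₂, ?_⟩
  · intro w hw1 hw2
    rw [hUd] at hw1
    rw [hVd] at hw2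
    refine hind w ?_ ?_
    · simpa [hc] using hw1
    · simpa [hd] using hw2
  · filter_upwards [he, hUe, hVe] with z hz hz1 hz2
    rw [hz, ← hz1, ← hz2]

/-! ### Zeros of the Hessian determinant -/

/-- A quarter of the Hessian determinant of `ω` in terms of `a = cos x` and `b = cos y`. -/
def hessianPoly (a b : ℝ) : ℝ :=
  a * b * (1 + 2 * a) * (1 + 2 * b) - 4 * (1 - a ^ 2) * (1 - b ^ 2)

/-- The derivative of `hessianPoly` along the kernel of the Hessian, up to a factor. -/
def hessianKernelDeriv (a b : ℝ) : ℝ :=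
  (1 + 2 * b) * a * (a + 4 * a * b + 2 * a ^ 2 + 8 * b) +
    2 * (1 - a ^ 2) * (b + 4 * a * b + 2 * b ^ 2 + 8 * a)

/-- At a zero of `hessianPoly`, the product of a(1 + 2b) and b(1 + 2a) equals 4(1 - a²)(1 - b²) ≥ 0,
which excludes some sign patterns. In each one left, the two summands of `hessianKernelDeriv` never
have opposite signs and the first is nonzero. -/
theorem hessianKernelDeriv_ne_zero {a b : ℝ} (ha : |a| ≤ 1) (hb : |b| ≤ 1) (ha0 : a ≠ 0)
    (hb0 : 1 + 2 * b ≠ 0) (h : hessianPoly a b = 0) : hessianKernelDeriv a b ≠ 0 := by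
  obtain ⟨ha1, ha2⟩ := abs_le.1 ha
  obtain ⟨hb1, hb2⟩ := abs_le.1 hb
  unfold hessianPoly at h
  unfold hessianKernelDeriv
  have hA : 0 ≤ 1 - a ^ 2 := by nlinarith
  have hB : 0 ≤ 1 - b ^ 2 := by nlinarith
  have hAB := mul_nonneg hA hB
  have hprod : 0 ≤ (a * (1 + 2 * b)) * (b * (1 + 2 * a)) := by nlinarith
  rcases eq_or_ne b 0 with rfl | hb00
  · have : (a - 1) * (a + 1) = 0 := by linarith
    rcases mul_eq_zero.1 this with h | h
    · obtain rfl : a = 1 := by linarith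
      norm_num
    · obtain rfl : a = -1 := by linarith
      norm_num
  rcases lt_or_gt_of_ne ha0 with ha' | ha' <;> rcases lt_or_gt_of_ne hb00 with hb' | hb'
  · rcases lt_or_gt_of_ne hb0 with hbb | hbb
    · have h1 : 0 < a * (1 + 2 * b) := mul_pos_of_neg_of_neg ha' hbb
      have h2 : 0 ≤ b * (1 + 2 * a) := nonneg_of_mul_nonneg_right hprod h1
      have h3 : 1 + 2 * a ≤ 0 := by
        by_contra! hc
        exact absurd h2 (not_le.2 (mul_neg_of_neg_of_pos hb' hc))
      have h4 : a + 4 * a * b + 2 * a ^ 2 + 8 * b < 0 := by nlinarith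
      have h5 : b + 4 * a * b + 2 * b ^ 2 + 8 * a < 0 := by nlinarith
      apply ne_of_lt
      nlinarith [mul_neg_of_pos_of_neg h1 h4, mul_nonneg hA (neg_pos.2 h5).le]
    · have h1 : a * (1 + 2 * b) < 0 := mul_neg_of_neg_of_pos ha' hbb
      have h3 : 0 ≤ 1 + 2 * a := by
        by_contra! hc
        exact absurd hprod (not_le.2 (mul_neg_of_neg_of_pos h1 (mul_pos_of_neg_of_neg hb' hc)))
      -- Now a and b lie in [-1/2, 0), so ab(1 + 2a)(1 + 2b) < 1/4, whereas 4(1 - a²)(1 - b²) ≥ 9/4.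
      exfalso
      nlinarith [mul_pos_of_neg_of_neg ha' hb']
  · have h1 : a * (1 + 2 * b) < 0 := mul_neg_of_neg_of_pos ha' (by linarith)
    have h3 : 1 + 2 * a ≤ 0 := by
      by_contra! hc
      exact absurd hprod (not_le.2 (mul_neg_of_neg_of_pos h1 (mul_pos hb' hc)))
    have h4 : 0 < a + 4 * a * b + 2 * a ^ 2 + 8 * b := by
      nlinarith [mul_nonneg_of_nonpos_of_nonpos ha'.le h3]
    have h5 : b + 4 * a * b + 2 * b ^ 2 + 8 * a < 0 := by nlinarith
    apply ne_of_lt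
    nlinarith [mul_neg_of_neg_of_pos h1 h4, mul_nonneg hA (neg_pos.2 h5).le]
  · rcases lt_or_gt_of_ne hb0 with hbb | hbb
    · have h1 : a * (1 + 2 * b) < 0 := mul_neg_of_pos_of_neg ha' hbb
      have h4 : a + 4 * a * b + 2 * a ^ 2 + 8 * b < 0 := by nlinarith
      have h5 : 0 < b + 4 * a * b + 2 * b ^ 2 + 8 * a := by nlinarith
      apply ne_of_gt
      nlinarith [mul_pos_of_neg_of_neg h1 h4, mul_nonneg hA h5.le]
    · exfalso
      nlinarith [mul_pos ha' hbb, mul_neg_of_neg_of_pos hb' (by linarith : 0 < 1 + 2 * a),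
        mul_neg_of_pos_of_neg (mul_pos ha' hbb)
          (mul_neg_of_neg_of_pos hb' (by linarith : 0 < 1 + 2 * a))]
  · apply ne_of_gt
    have : 0 ≤ 2 * (1 - a ^ 2) * (b + 4 * a * b + 2 * b ^ 2 + 8 * a) := by positivity
    positivity

/-! ### Taylor quotients, local arcsine and orders of vanishing -/

theorem analyticOrderAt_one_sub_cos : analyticOrderAt (fun t : ℝ => 1 - Real.cos t) 0 = 2 := by
  have hs : analyticOrderAt Real.sin 0 = 1 :=
    AnalyticAt.analyticOrderAt_eq_one_of_zero_deriv_ne_zero (by fun_prop) (by simp) (by simp)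
  have h := AnalyticAt.analyticOrderAt_deriv_add_one (𝕜 := ℝ)
    (f := fun t : ℝ => 1 - Real.cos t) (x := 0) (by fun_prop)
  have hd : deriv (fun t : ℝ => 1 - Real.cos t) = Real.sin := by
    ext t
    simp
  rw [hd, hs] at h
  simp only [Real.cos_zero, sub_self, sub_zero] at h
  rw [← h]
  rfl

theorem exists_one_sub_cos_eq_sq_mul : ∃ α : ℝ → ℝ, AnalyticAt ℝ α 0 ∧ α 0 ≠ 0 ∧
    ∀ᶠ t in 𝓝 (0 : ℝ), 1 - Real.cos t = t ^ 2 * α t := by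
  have h := (AnalyticAt.analyticOrderAt_eq_natCast (𝕜 := ℝ) (f := fun t : ℝ => 1 - Real.cos t)
    (n := 2) (z₀ := 0) (by fun_prop)).1 analyticOrderAt_one_sub_cos
  simpa using h

/-- The remainder has order three, so the quotient by t² still vanishes at 0; hence β does not
affect the base-point values of the coefficients built from it. -/
theorem exists_sin_sub_self_eq_sq_mul : ∃ β : ℝ → ℝ, AnalyticAt ℝ β 0 ∧ β 0 = 0 ∧
    ∀ᶠ t in 𝓝 (0 : ℝ), Real.sin t - t = t ^ 2 * β t := by
  have h := AnalyticAt.analyticOrderAt_deriv_add_one (𝕜 := ℝ)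
    (f := fun t : ℝ => t - Real.sin t) (x := 0) (by fun_prop)
  have hd : deriv (fun t : ℝ => t - Real.sin t) = fun t => 1 - Real.cos t := by
    ext t
    rw [deriv_fun_sub (by fun_prop) (by fun_prop)]
    simp
  rw [hd, analyticOrderAt_one_sub_cos] at h
  simp only [Real.sin_zero, sub_self, sub_zero] at h
  obtain ⟨g, hg, -, he⟩ := (AnalyticAt.analyticOrderAt_eq_natCast (𝕜 := ℝ)
    (f := fun t : ℝ => t - Real.sin t) (n := 3) (z₀ := 0) (by fun_prop)).1 (by rw [← h]; rfl)
  refine ⟨fun t => -(t * g t), by fun_prop, by simp, ?_⟩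
  filter_upwards [he] with t ht
  simp only [sub_zero, smul_eq_mul] at ht
  linear_combination -ht

/-- A local inverse of the sine near a point where the cosine does not vanish. -/
theorem exists_local_arcsin {x₀ : ℝ} (h : Real.cos x₀ ≠ 0) :
    ∃ ψ : ℝ → ℝ, ContDiffAt ℝ ω ψ (Real.sin x₀) ∧ ψ (Real.sin x₀) = x₀ ∧
      ∀ᶠ s in 𝓝 (Real.sin x₀), Real.sin (ψ s) = s := by
  have hs : ContDiffAt ℝ ω Real.sin x₀ := Real.contDiff_sin.contDiffAt
  have hd := (Real.hasDerivAt_sin x₀).hasFDerivAt_equiv h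
  refine ⟨hs.localInverse hd (by simp), hs.to_localInverse hd (by simp),
    hs.localInverse_apply_image hd (by simp), ?_⟩
  exact (hs.hasStrictFDerivAt' hd (by simp)).eventually_right_inverse

theorem analyticOrderAt_sin_le_one (y : ℝ) : analyticOrderAt Real.sin y ≤ 1 := by
  by_cases h : Real.sin y = 0
  · refine (AnalyticAt.analyticOrderAt_eq_one_of_zero_deriv_ne_zero (by fun_prop) h ?_).le
    rw [Real.deriv_sin]
    intro hc
    have := Real.sin_sq_add_cos_sq y
    rw [h, hc] at this
    norm_num at this
  · rw [(AnalyticAt.analyticOrderAt_eq_zero (by fun_prop)).2 h]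
    exact zero_le_one

theorem analyticOrderAt_mul_of_ne_zero {f g : ℝ → ℝ} {y : ℝ} (hf : AnalyticAt ℝ f y)
    (hg : AnalyticAt ℝ g y) (h : g y ≠ 0) :
    analyticOrderAt (fun t => f t * g t) y = analyticOrderAt f y := by
  have := analyticOrderAt_mul hf hg
  rw [hg.analyticOrderAt_eq_zero.2 h, add_zero] at this
  exact this

/-- The order of vanishing of the Hessian determinant along a critical curve is at most two. -/
theorem analyticOrderAt_hessianPoly_le_two {φ : ℝ → ℝ} {y₀ : ℝ} (hφ : AnalyticAt ℝ φ y₀)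
    (ha : Real.cos (φ y₀) ≠ 0) (hb : 1 + 2 * Real.cos y₀ ≠ 0)
    (hd : ∀ᶠ y in 𝓝 y₀, HasDerivAt φ
      (2 * Real.sin y * Real.sin (φ y) / ((1 + 2 * Real.cos y) * Real.cos (φ y))) y) :
    analyticOrderAt (fun y => hessianPoly (Real.cos (φ y)) (Real.cos y)) y₀ ≤ 2 := by
  have hE : AnalyticAt ℝ (fun y => hessianPoly (Real.cos (φ y)) (Real.cos y)) y₀ := by
    unfold hessianPoly
    fun_prop
  by_cases hE0 : hessianPoly (Real.cos (φ y₀)) (Real.cos y₀) = 0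
  swap
  · rw [hE.analyticOrderAt_eq_zero.2 hE0]
    exact bot_le
  have hK := hessianKernelDeriv_ne_zero (Real.abs_cos_le_one _) (Real.abs_cos_le_one _) ha hb hE0
  have hden : (1 + 2 * Real.cos y₀) * Real.cos (φ y₀) ≠ 0 := mul_ne_zero hb ha
  set G : ℝ → ℝ := fun y => -(hessianKernelDeriv (Real.cos (φ y)) (Real.cos y) /
    ((1 + 2 * Real.cos y) * Real.cos (φ y))) with hG
  have hGa : AnalyticAt ℝ G y₀ := by
    unfold G hessianKernelDeriv
    fun_prop (disch := exact hden)
  have hG0 : G y₀ ≠ 0 := neg_ne_zero.2 (div_ne_zero hK hden)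
  have hφc := hφ.continuousAt
  have hne : ∀ᶠ y in 𝓝 y₀, (1 + 2 * Real.cos y) * Real.cos (φ y) ≠ 0 :=
    ContinuousAt.eventually_ne (by fun_prop) hden
  -- The slope of φ contains the factor sin y, so sin y divides both chain-rule terms; sin φ then
  -- occurs only squared.
  have hderiv : deriv (fun y => hessianPoly (Real.cos (φ y)) (Real.cos y)) =ᶠ[𝓝 y₀]
      fun y => Real.sin y * G y := by
    filter_upwards [hd, hne] with y hy hny
    have h1 := hy.cos
    have h2 := Real.hasDerivAt_cos y
    have h3 := (((h1.mul h2).mul ((h1.const_mul 2).const_add 1)).mul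
      ((h2.const_mul 2).const_add 1)).sub
      ((((h1.pow 2).const_sub 1).const_mul 4).mul ((h2.pow 2).const_sub 1))
    have h4 := h3.deriv
    obtain ⟨hn1, hn2⟩ := mul_ne_zero_iff.1 hny
    refine h4.trans ?_
    simp only [G, hessianKernelDeriv, Pi.mul_apply, Pi.pow_apply]
    field_simp
    simp only [Real.sin_sq (φ y)]
    ring
  have hsum := hE.analyticOrderAt_deriv_add_one
  rw [analyticOrderAt_congr hderiv, analyticOrderAt_mul_of_ne_zero (by fun_prop) hGa hG0] at hsum
  simp only [hE0, sub_zero] at hsum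
  rw [← hsum]
  calc _ ≤ (1 : ℕ∞) + 1 := by gcongr; exact analyticOrderAt_sin_le_one y₀
    _ = 2 := by norm_num

/-! ### Splitting off the nondegenerate variable -/

/-- The phase in explicit coordinates. -/
noncomputable def trigPhase (x₀ y₀ : ℝ) (z : ℝ × ℝ) : ℝ :=
  8 - 2 * Real.cos z.1 - 2 * Real.cos z.2 - 4 * Real.cos z.1 * Real.cos z.2
    - 2 * Real.sin x₀ * (1 + 2 * Real.cos y₀) * z.1 - 2 * Real.sin y₀ * (1 + 2 * Real.cos x₀) * z.2

theorem trigPhase_comp_swap (x₀ y₀ : ℝ) : trigPhase x₀ y₀ ∘ Prod.swap = trigPhase y₀ x₀ := by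
  ext z
  simp only [trigPhase, Function.comp, Prod.fst_swap, Prod.snd_swap]
  ring

/-- The critical curve of the phase in the first variable. -/
theorem exists_critical_curve {x₀ y₀ : ℝ} (ha : Real.cos x₀ ≠ 0) (hb : 1 + 2 * Real.cos y₀ ≠ 0) :
    ∃ φ : ℝ → ℝ, AnalyticAt ℝ φ y₀ ∧ φ y₀ = x₀ ∧
      (∀ᶠ y in 𝓝 y₀, (1 + 2 * Real.cos y) * Real.sin (φ y) =
        Real.sin x₀ * (1 + 2 * Real.cos y₀)) ∧
      ∀ᶠ y in 𝓝 y₀, HasDerivAt φ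
        (2 * Real.sin y * Real.sin (φ y) / ((1 + 2 * Real.cos y) * Real.cos (φ y))) y := by
  obtain ⟨ψ, hψ, hψ0, hψs⟩ := exists_local_arcsin ha
  set s : ℝ → ℝ := fun y => Real.sin x₀ * (1 + 2 * Real.cos y₀) / (1 + 2 * Real.cos y) with hs
  have hs0 : s y₀ = Real.sin x₀ := mul_div_cancel_right₀ _ hb
  have hsa : AnalyticAt ℝ s y₀ := by
    unfold s
    fun_prop (disch := exact hb)
  have hφ : AnalyticAt ℝ (fun y => ψ (s y)) y₀ :=
    AnalyticAt.fun_comp (g := ψ) (by rw [hs0]; exact hψ.analyticAt) hsa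
  have hφ0 : ψ (s y₀) = x₀ := by rw [hs0, hψ0]
  have hne : ∀ᶠ y in 𝓝 y₀, 1 + 2 * Real.cos y ≠ 0 :=
    ContinuousAt.eventually_ne (by fun_prop) hb
  have hst : Tendsto s (𝓝 y₀) (𝓝 (Real.sin x₀)) := by
    have := hsa.continuousAt.tendsto
    rwa [hs0] at this
  have hcurve : ∀ᶠ y in 𝓝 y₀, (1 + 2 * Real.cos y) * Real.sin (ψ (s y)) =
      Real.sin x₀ * (1 + 2 * Real.cos y₀) := by
    filter_upwards [hst.eventually hψs, hne] with y hy hny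
    rw [hy]
    exact mul_div_cancel₀ _ hny
  refine ⟨fun y => ψ (s y), hφ, hφ0, hcurve, ?_⟩
  have hφc := hφ.continuousAt
  have hcos : ∀ᶠ y in 𝓝 y₀, Real.cos (ψ (s y)) ≠ 0 := by
    refine ContinuousAt.eventually_ne (Real.continuous_cos.continuousAt.comp' hφc) ?_
    simpa only [hφ0] using ha
  filter_upwards [hφ.eventually_analyticAt, hcurve.eventually_nhds, hne, hcos]
    with y hya hyc hyn hycos
  have hd := hya.differentiableAt.hasDerivAt
  have h1 : HasDerivAt (fun y => (1 + 2 * Real.cos y) * Real.sin (ψ (s y))) 0 y :=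
    (hasDerivAt_const y (Real.sin x₀ * (1 + 2 * Real.cos y₀))).congr_of_eventuallyEq hyc
  have h2 := (((Real.hasDerivAt_cos y).const_mul 2).const_add 1).mul hd.sin
  have h3 := h1.unique h2
  refine hd.congr_deriv ?_
  rw [eq_div_iff (mul_ne_zero hyn hycos)]
  linear_combination -h3

/-- After eliminating the first variable, the phase vanishes to order between two and four. -/
theorem exists_reduced_phase {x₀ y₀ : ℝ} {φ : ℝ → ℝ} (hφ : AnalyticAt ℝ φ y₀) (hφ0 : φ y₀ = x₀)
    (ha : Real.cos x₀ ≠ 0) (hb : 1 + 2 * Real.cos y₀ ≠ 0)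
    (hcurve : ∀ᶠ y in 𝓝 y₀, (1 + 2 * Real.cos y) * Real.sin (φ y) =
      Real.sin x₀ * (1 + 2 * Real.cos y₀))
    (hd : ∀ᶠ y in 𝓝 y₀, HasDerivAt φ
      (2 * Real.sin y * Real.sin (φ y) / ((1 + 2 * Real.cos y) * Real.cos (φ y))) y) :
    ∃ k : ℕ, 1 ≤ k ∧ k ≤ 3 ∧ ∃ m : ℝ → ℝ, AnalyticAt ℝ m y₀ ∧ m y₀ ≠ 0 ∧
      ∀ᶠ y in 𝓝 y₀, trigPhase x₀ y₀ (φ y, y) =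
        trigPhase x₀ y₀ (x₀, y₀) + (y - y₀) ^ (k + 1) * m y := by
  subst hφ0
  have hden : (1 + 2 * Real.cos y₀) * Real.cos (φ y₀) ≠ 0 := mul_ne_zero hb ha
  have hφc := hφ.continuousAt
  have hne : ∀ᶠ y in 𝓝 y₀, (1 + 2 * Real.cos y) * Real.cos (φ y) ≠ 0 :=
    ContinuousAt.eventually_ne (by fun_prop) hden
  set h : ℝ → ℝ := fun y => trigPhase (φ y₀) y₀ (φ y, y) with hh
  set h₁ : ℝ → ℝ := fun y => 2 * Real.sin y * (1 + 2 * Real.cos (φ y)) -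
    2 * Real.sin y₀ * (1 + 2 * Real.cos (φ y₀)) with hh₁
  set E : ℝ → ℝ := fun y => hessianPoly (Real.cos (φ y)) (Real.cos y) with hE
  -- `E` is a quarter of the determinant and the second x-derivative is 2 cos φ (1 + 2 cos y),
  -- whence the numerator 2.
  set c : ℝ → ℝ := fun y => 2 / ((1 + 2 * Real.cos y) * Real.cos (φ y)) with hc
  have hha : AnalyticAt ℝ h y₀ := by
    unfold h trigPhase
    fun_prop
  have hh₁a : AnalyticAt ℝ h₁ y₀ := by
    unfold h₁
    fun_prop
  have hEa : AnalyticAt ℝ E y₀ := by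
    unfold E hessianPoly
    fun_prop
  have hca : AnalyticAt ℝ c y₀ := by
    unfold c
    fun_prop (disch := exact hden)
  -- On the curve the x-derivative of the phase is zero, so only its y-derivative contributes.
  have hd1 : deriv h =ᶠ[𝓝 y₀] h₁ := by
    filter_upwards [hd, hcurve] with y hy hcy
    have h1 := hy.cos
    have h2 := Real.hasDerivAt_cos y
    have h3 := ((((h1.const_mul 2).const_sub 8).sub (h2.const_mul 2)).sub
      ((h1.const_mul 4).mul h2)).sub
      (hy.const_mul (2 * Real.sin (φ y₀) * (1 + 2 * Real.cos y₀))) |>.sub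
      ((hasDerivAt_id y).const_mul (2 * Real.sin y₀ * (1 + 2 * Real.cos (φ y₀))))
    refine h3.deriv.trans ?_
    simp only [h₁]
    linear_combination (2 * (2 * Real.sin y * Real.sin (φ y) /
      ((1 + 2 * Real.cos y) * Real.cos (φ y)))) * hcy
  have hd2 : deriv h₁ =ᶠ[𝓝 y₀] fun y => E y * c y := by
    filter_upwards [hd, hne] with y hy hny
    have h3 := (((Real.hasDerivAt_sin y).const_mul 2).mul
      ((hy.cos.const_mul 2).const_add 1)).sub_const
      (2 * Real.sin y₀ * (1 + 2 * Real.cos (φ y₀)))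
    have hs := Real.sin_sq_add_cos_sq (φ y)
    have hs' := Real.sin_sq_add_cos_sq y
    obtain ⟨hn1, hn2⟩ := mul_ne_zero_iff.1 hny
    refine h3.deriv.trans ?_
    simp only [E, c, hessianPoly]
    rw [show 1 - Real.cos (φ y) ^ 2 = Real.sin (φ y) ^ 2 by linarith,
      show 1 - Real.cos y ^ 2 = Real.sin y ^ 2 by linarith]
    field_simp
    ring
  have hord : analyticOrderAt (fun y => h y - h y₀) y₀ = analyticOrderAt E y₀ + 1 + 1 := by
    have e2 := hh₁a.analyticOrderAt_deriv_add_one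
    have e1 := hha.analyticOrderAt_deriv_add_one
    have hz : h₁ y₀ = 0 := sub_self _
    simp only [hz, sub_zero] at e2
    rw [analyticOrderAt_congr hd2, analyticOrderAt_mul_of_ne_zero hEa hca
      (div_ne_zero two_ne_zero hden)] at e2
    rw [analyticOrderAt_congr hd1] at e1
    rw [← e1, e2]
  have hle : analyticOrderAt E y₀ ≤ 2 := analyticOrderAt_hessianPoly_le_two hφ ha hb hd
  obtain ⟨n, hn⟩ := ENat.ne_top_iff_exists.1 (ne_top_of_le_ne_top (by simp) hle)
  rw [← hn] at hle hord
  have hn2 : n ≤ 2 := by exact_mod_cast hle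
  obtain ⟨m, hm, hm0, he⟩ := (AnalyticAt.analyticOrderAt_eq_natCast (n := n + 1 + 1)
    (hha.sub analyticAt_const)).1 (by rw [Nat.cast_add, Nat.cast_add]; exact hord)
  -- If `E` has order n, two integrations give order n + 2 = k + 1.
  refine ⟨n + 1, by omega, by omega, m, hm, hm0, ?_⟩
  filter_upwards [he] with y hy
  simp only [smul_eq_mul, Pi.sub_apply] at hy
  linear_combination hy

/-- An explicit splitting: put t = x - φ(y) and expand cos(φ + t). The curve equation cancels the
linear term in t, leaving t² times 2(1 + 2 cos y)(cos φ · α(t) + sin φ · β(t)), a unit because β(0)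
= 0. -/
theorem exists_hasNormalFormA_of_cos_ne_zero {x₀ y₀ : ℝ} (ha : Real.cos x₀ ≠ 0)
    (hb : 1 + 2 * Real.cos y₀ ≠ 0) :
    ∃ k : ℕ, 1 ≤ k ∧ k ≤ 3 ∧ HasNormalFormA k (trigPhase x₀ y₀) (x₀, y₀) := by
  obtain ⟨φ, hφ, hφ0, hcurve, hd⟩ := exists_critical_curve ha hb
  obtain ⟨k, hk1, hk3, m, hm, hm0, hme⟩ := exists_reduced_phase hφ hφ0 ha hb hcurve hd
  obtain ⟨α, hα, hα0, hαe⟩ := exists_one_sub_cos_eq_sq_mul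
  obtain ⟨β, hβ, hβ0, hβe⟩ := exists_sin_sub_self_eq_sq_mul
  have hφc : ContDiffAt ℝ ω φ y₀ := hφ.contDiffAt
  have hφz : ContDiffAt ℝ ω (fun z : ℝ × ℝ => φ z.2) (x₀, y₀) :=
    ContDiffAt.comp (x₀, y₀) (g := φ) hφc contDiffAt_snd
  have ht : ContDiffAt ℝ ω (fun z : ℝ × ℝ => z.1 - φ z.2) (x₀, y₀) := contDiffAt_fst.sub hφz
  have ht0 : x₀ - φ y₀ = 0 := by rw [hφ0, sub_self]
  have hαz : ContDiffAt ℝ ω (fun z : ℝ × ℝ => α (z.1 - φ z.2)) (x₀, y₀) :=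
    ContDiffAt.comp (x₀, y₀) (g := α) (by simpa only [ht0] using hα.contDiffAt) ht
  have hβz : ContDiffAt ℝ ω (fun z : ℝ × ℝ => β (z.1 - φ z.2)) (x₀, y₀) :=
    ContDiffAt.comp (x₀, y₀) (g := β) (by simpa only [ht0] using hβ.contDiffAt) ht
  have htt : Tendsto (fun z : ℝ × ℝ => z.1 - φ z.2) (𝓝 (x₀, y₀)) (𝓝 0) := by
    have := ht.continuousAt.tendsto
    simpa only [ht0] using this
  have hsnd : Tendsto (fun z : ℝ × ℝ => z.2) (𝓝 (x₀, y₀)) (𝓝 y₀) :=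
    continuous_snd.tendsto (x₀, y₀)
  refine ⟨k, hk1, hk3, HasNormalFormA.of_unit_coefficients (g₁ := fun z => z.2 - y₀)
    (g₂ := fun z => z.1 - φ z.2) (r₁ := fun z => m z.2)
    (r₂ := fun z => 2 * (1 + 2 * Real.cos z.2) * (Real.cos (φ z.2) * α (z.1 - φ z.2) +
      Real.sin (φ z.2) * β (z.1 - φ z.2))) (by fun_prop) ht
    (ContDiffAt.comp (x₀, y₀) (g := m) hm.contDiffAt contDiffAt_snd)
    ((contDiffAt_const.mul (contDiffAt_const.add (contDiffAt_const.mul contDiffAt_snd.cos))).mul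
      ((hφz.cos.mul hαz).add (hφz.sin.mul hβz)))
    (sub_self _) ht0 hm0 ?_ ?_ ?_⟩
  · simp only [hφ0, sub_self, hβ0, mul_zero, add_zero]
    exact mul_ne_zero (mul_ne_zero two_ne_zero hb) (mul_ne_zero ha hα0)
  · intro w hw1 hw2
    have h1 : HasFDerivAt (fun z : ℝ × ℝ => z.2 - y₀) (ContinuousLinearMap.snd ℝ ℝ ℝ) (x₀, y₀) :=
      hasFDerivAt_snd.sub_const y₀
    have h2 : HasFDerivAt (fun z : ℝ × ℝ => z.1 - φ z.2) (ContinuousLinearMap.fst ℝ ℝ ℝ -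
        (fderiv ℝ φ y₀).comp (ContinuousLinearMap.snd ℝ ℝ ℝ)) (x₀, y₀) :=
      hasFDerivAt_fst.sub (HasFDerivAt.comp (x₀, y₀) (g := φ)
        (hφc.differentiableAt (by simp)).hasFDerivAt hasFDerivAt_snd)
    rw [h1.fderiv] at hw1
    rw [h2.fderiv] at hw2
    have hw1' : w.2 = 0 := hw1
    have hw2' : w.1 - fderiv ℝ φ y₀ w.2 = 0 := hw2
    rw [hw1', map_zero, sub_zero] at hw2'
    exact Prod.ext hw2' hw1'
  · filter_upwards [htt.eventually hαe, htt.eventually hβe, hsnd.eventually hme,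
      hsnd.eventually hcurve] with z hz1 hz2 hz3 hz4
    have hcos : Real.cos z.1 = Real.cos (φ z.2) * Real.cos (z.1 - φ z.2) -
        Real.sin (φ z.2) * Real.sin (z.1 - φ z.2) := by
      rw [← Real.cos_add]
      congr 1
      ring
    simp only [trigPhase] at hz3 ⊢
    rw [hcos]
    linear_combination hz3 + 2 * (1 + 2 * Real.cos z.2) * (Real.cos (φ z.2) * hz1 +
      Real.sin (φ z.2) * hz2) + 2 * (z.1 - φ z.2) * hz4

/-! ### The exceptional saddle points -/

/-- The linear form vanishes, and the phase is 9 - (1 + 2a)(1 + 2b) = 9 - (1 + a + b)² + (a - b)².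
The sines are nonzero, so the cosines serve as local coordinates. -/
theorem hasNormalFormA_of_cos_eq_neg_half {x₀ y₀ : ℝ} (ha : 1 + 2 * Real.cos x₀ = 0)
    (hb : 1 + 2 * Real.cos y₀ = 0) : HasNormalFormA 1 (trigPhase x₀ y₀) (x₀, y₀) := by
  have hsin : ∀ t, 1 + 2 * Real.cos t = 0 → Real.sin t ≠ 0 := by
    intro t ht hs
    have := Real.sin_sq_add_cos_sq t
    rw [hs, show Real.cos t = -1 / 2 by linarith] at this
    norm_num at this
  have hcx : ∀ z : ℝ × ℝ, HasFDerivAt (fun z : ℝ × ℝ => Real.cos z.1)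
      (-Real.sin z.1 • ContinuousLinearMap.fst ℝ ℝ ℝ) z := fun z => hasFDerivAt_fst.cos
  have hcy : ∀ z : ℝ × ℝ, HasFDerivAt (fun z : ℝ × ℝ => Real.cos z.2)
      (-Real.sin z.2 • ContinuousLinearMap.snd ℝ ℝ ℝ) z := fun z => hasFDerivAt_snd.cos
  refine HasNormalFormA.of_unit_coefficients
    (g₁ := fun z => 1 + Real.cos z.1 + Real.cos z.2) (g₂ := fun z => Real.cos z.1 - Real.cos z.2)
    (r₁ := fun _ => -1) (r₂ := fun _ => 1)
    ((contDiffAt_const.add contDiffAt_fst.cos).add contDiffAt_snd.cos)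
    (contDiffAt_fst.cos.sub contDiffAt_snd.cos) contDiffAt_const contDiffAt_const
    (by dsimp only; linarith) (by dsimp only; linarith) (by norm_num) one_ne_zero ?_ ?_
  · intro w hw1 hw2
    rw [(((hcx _).const_add 1).fun_add (hcy _)).fderiv] at hw1
    rw [((hcx _).fun_sub (hcy _)).fderiv] at hw2
    simp only [add_apply, sub_apply, smul_apply, ContinuousLinearMap.coe_fst',
      ContinuousLinearMap.coe_snd', smul_eq_mul] at hw1 hw2
    have h1 : Real.sin x₀ * w.1 = 0 := by linarith
    have h2 : Real.sin y₀ * w.2 = 0 := by linarith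
    exact Prod.ext ((mul_eq_zero.1 h1).resolve_left (hsin _ ha))
      ((mul_eq_zero.1 h2).resolve_left (hsin _ hb))
  · refine Eventually.of_forall fun z => ?_
    simp only [trigPhase, ha, hb]
    linear_combination (1 + 2 * Real.cos y₀) * ha

theorem hasNormalFormA_of_cos_eq_zero {x₀ y₀ : ℝ} (ha : Real.cos x₀ = 0)
    (hb : Real.cos y₀ = 0) : HasNormalFormA 1 (trigPhase x₀ y₀) (x₀, y₀) := by
  obtain ⟨β, hβ, hβ0, hβe⟩ := exists_sin_sub_self_eq_sq_mul
  have hsin : ∀ t, Real.cos t = 0 → Real.sin t ≠ 0 := by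
    intro t ht hs
    have := Real.sin_sq_add_cos_sq t
    rw [hs, ht] at this
    norm_num at this
  have hx := hsin _ ha
  have hy := hsin _ hb
  have hξ : ContDiffAt ℝ ω (fun z : ℝ × ℝ => z.1 - x₀) (x₀, y₀) := by fun_prop
  have hη : ContDiffAt ℝ ω (fun z : ℝ × ℝ => z.2 - y₀) (x₀, y₀) := by fun_prop
  set b₁ : ℝ × ℝ → ℝ := fun z => β (z.1 - x₀)
  set b₂ : ℝ × ℝ → ℝ := fun z => β (z.2 - y₀)
  have hb₁ : ContDiffAt ℝ ω b₁ (x₀, y₀) :=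
    ContDiffAt.comp (x₀, y₀) (g := β) (by simpa only [sub_self] using hβ.contDiffAt) hξ
  have hb₂ : ContDiffAt ℝ ω b₂ (x₀, y₀) :=
    ContDiffAt.comp (x₀, y₀) (g := β) (by simpa only [sub_self] using hβ.contDiffAt) hη
  have hb₁0 : b₁ (x₀, y₀) = 0 := by simp only [b₁, sub_self, hβ0]
  have hb₂0 : b₂ (x₀, y₀) = 0 := by simp only [b₂, sub_self, hβ0]
  -- the phase is `A ξ² + 2 B ξ η + C η²` up to a constant
  set A : ℝ × ℝ → ℝ := fun z => 2 * Real.sin x₀ * b₁ z with hA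
  set C : ℝ × ℝ → ℝ := fun z => 2 * Real.sin y₀ * b₂ z with hC
  set B : ℝ × ℝ → ℝ := fun z => -(2 * Real.sin x₀ * Real.sin y₀ *
    ((1 + (z.1 - x₀) * b₁ z) * (1 + (z.2 - y₀) * b₂ z))) with hB
  have hAc : ContDiffAt ℝ ω A (x₀, y₀) := by fun_prop
  have hCc : ContDiffAt ℝ ω C (x₀, y₀) := by fun_prop
  have hBc : ContDiffAt ℝ ω B (x₀, y₀) := by fun_prop
  have hA0 : A (x₀, y₀) = 0 := by simp only [A, hb₁0, mul_zero]
  have hC0 : C (x₀, y₀) = 0 := by simp only [C, hb₂0, mul_zero]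
  have hB0 : B (x₀, y₀) ≠ 0 := by
    simp only [B, hb₁0, hb₂0]
    simp [hx, hy]
  -- `A` and `C` vanish at the point, so no square can be completed in ξ or η. In the half-sum `S`
  -- and half-difference `T` the coefficient of S² is `P`, equal to 2B ≠ 0 at the point, and
  -- completing the square shifts `S` by `Q` times `T`.
  set P : ℝ × ℝ → ℝ := fun z => A z + 2 * B z + C z with hP
  have hPc : ContDiffAt ℝ ω P (x₀, y₀) := by fun_prop
  have hP0 : P (x₀, y₀) = 2 * B (x₀, y₀) := by simp only [P, hA0, hC0]; ring
  have hP0' : P (x₀, y₀) ≠ 0 := by rw [hP0]; exact mul_ne_zero two_ne_zero hB0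
  set Q : ℝ × ℝ → ℝ := fun z => (A z - C z) / P z with hQ
  have hQc : ContDiffAt ℝ ω Q (x₀, y₀) := (hAc.sub hCc).div hPc hP0'
  have hQ0 : Q (x₀, y₀) = 0 := by simp only [Q, hA0, hC0, sub_self, zero_div]
  set S : ℝ × ℝ → ℝ := fun z => (z.1 - x₀ + (z.2 - y₀)) / 2
  set T : ℝ × ℝ → ℝ := fun z => (z.1 - x₀ - (z.2 - y₀)) / 2
  have hS0 : S (x₀, y₀) = 0 := by simp [S]
  have hT0 : T (x₀, y₀) = 0 := by simp [T]
  have hSc : ContDiffAt ℝ ω S (x₀, y₀) := by fun_prop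
  have hTc : ContDiffAt ℝ ω T (x₀, y₀) := by fun_prop
  have hSd : ∀ w, fderiv ℝ S (x₀, y₀) w = (w.1 + w.2) / 2 := by
    intro w
    have : HasFDerivAt S ((2 : ℝ)⁻¹ • (ContinuousLinearMap.fst ℝ ℝ ℝ +
        ContinuousLinearMap.snd ℝ ℝ ℝ)) (x₀, y₀) := by
      have := ((hasFDerivAt_fst (𝕜 := ℝ) (p := (x₀, y₀))).sub_const x₀ |>.add
        ((hasFDerivAt_snd (𝕜 := ℝ) (p := (x₀, y₀))).sub_const y₀)).mul_const (2 : ℝ)⁻¹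
      exact this
    rw [this.fderiv]
    exact inv_mul_eq_div _ _
  have hTd : ∀ w, fderiv ℝ T (x₀, y₀) w = (w.1 - w.2) / 2 := by
    intro w
    have : HasFDerivAt T ((2 : ℝ)⁻¹ • (ContinuousLinearMap.fst ℝ ℝ ℝ -
        ContinuousLinearMap.snd ℝ ℝ ℝ)) (x₀, y₀) := by
      have := ((hasFDerivAt_fst (𝕜 := ℝ) (p := (x₀, y₀))).sub_const x₀ |>.sub
        ((hasFDerivAt_snd (𝕜 := ℝ) (p := (x₀, y₀))).sub_const y₀)).mul_const (2 : ℝ)⁻¹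
      exact this
    rw [this.fderiv]
    exact inv_mul_eq_div _ _
  refine HasNormalFormA.of_unit_coefficients
    (g₁ := fun z => S z + Q z * T z) (g₂ := T) (r₁ := P)
    (r₂ := fun z => A z - 2 * B z + C z - (A z - C z) * Q z)
    (by fun_prop) hTc hPc (by fun_prop) (by simp only [hS0, hT0, hQ0]; ring) hT0 hP0' ?_ ?_ ?_
  · simp only [hA0, hC0, hQ0]
    simpa using hB0
  · intro w hw1 hw2
    have h1 := ((hSc.differentiableAt (by simp)).hasFDerivAt.add
      ((hQc.differentiableAt (by simp)).hasFDerivAt.mul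
        (hTc.differentiableAt (by simp)).hasFDerivAt)).fderiv
    have h1' : fderiv ℝ (fun z => S z + Q z * T z) (x₀, y₀) = fderiv ℝ S (x₀, y₀) := by
      refine h1.trans ?_
      rw [hQ0, hT0, zero_smul, zero_smul, add_zero, add_zero]
    rw [h1', hSd] at hw1
    rw [hTd] at hw2
    exact Prod.ext (by simp only [Prod.fst_zero]; linarith) (by simp only [Prod.snd_zero]; linarith)
  · have hξt : Tendsto (fun z : ℝ × ℝ => z.1 - x₀) (𝓝 (x₀, y₀)) (𝓝 0) := by
      simpa only [sub_self] using hξ.continuousAt.tendsto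
    have hηt : Tendsto (fun z : ℝ × ℝ => z.2 - y₀) (𝓝 (x₀, y₀)) (𝓝 0) := by
      simpa only [sub_self] using hη.continuousAt.tendsto
    filter_upwards [hξt.eventually hβe, hηt.eventually hβe,
      hPc.continuousAt.eventually_ne hP0'] with z hz1 hz2 hz3
    have hcx : Real.cos z.1 = -(Real.sin x₀ * Real.sin (z.1 - x₀)) := by
      have := Real.cos_add x₀ (z.1 - x₀)
      rw [add_sub_cancel, ha] at this
      linarith
    have hcy : Real.cos z.2 = -(Real.sin y₀ * Real.sin (z.2 - y₀)) := by
      have := Real.cos_add y₀ (z.2 - y₀)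
      rw [add_sub_cancel, hb] at this
      linarith
    have hQP : Q z * P z = A z - C z := div_mul_cancel₀ _ hz3
    have hs1 : Real.sin (z.1 - x₀) = (z.1 - x₀) + (z.1 - x₀) ^ 2 * b₁ z := by linarith
    have hs2 : Real.sin (z.2 - y₀) = (z.2 - y₀) + (z.2 - y₀) ^ 2 * b₂ z := by linarith
    have hquad : trigPhase x₀ y₀ z = trigPhase x₀ y₀ (x₀, y₀) + A z * (z.1 - x₀) ^ 2 +
        2 * B z * (z.1 - x₀) * (z.2 - y₀) + C z * (z.2 - y₀) ^ 2 := by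
      simp only [trigPhase, hcx, hcy, ha, hb, hs1, hs2, A, B, C]
      ring
    have hx' : z.1 - x₀ = S z + T z := by simp only [S, T]; ring
    have hy' : z.2 - y₀ = S z - T z := by simp only [S, T]; ring
    rw [hquad, hx', hy']
    have hPz : P z = A z + 2 * B z + C z := rfl
    linear_combination (-(2 * S z * T z) - Q z * T z ^ 2) * hQP - S z ^ 2 * hPz

/-! ### Case distinction and return to the Euclidean plane -/

theorem exists_hasNormalFormA (x₀ y₀ : ℝ) :
    ∃ k : ℕ, 1 ≤ k ∧ k ≤ 3 ∧ HasNormalFormA k (trigPhase x₀ y₀) (x₀, y₀) := by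
  by_cases h₁ : Real.cos x₀ ≠ 0 ∧ 1 + 2 * Real.cos y₀ ≠ 0
  · exact exists_hasNormalFormA_of_cos_ne_zero h₁.1 h₁.2
  by_cases h₂ : Real.cos y₀ ≠ 0 ∧ 1 + 2 * Real.cos x₀ ≠ 0
  · obtain ⟨k, hk1, hk3, hk⟩ := exists_hasNormalFormA_of_cos_ne_zero h₂.1 h₂.2
    refine ⟨k, hk1, hk3, ?_⟩
    have := hk.swap
    rwa [trigPhase_comp_swap] at this
  -- A cosine cannot be both 0 and -1/2, so failure of both conditions forces the two cosines to be
  -- equal, to 0 or to -1/2.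
  refine ⟨1, le_rfl, by norm_num, ?_⟩
  by_cases ha : Real.cos x₀ = 0
  · have hb : Real.cos y₀ = 0 := by
      by_contra hb
      exact h₂ ⟨hb, by rw [ha]; norm_num⟩
    exact hasNormalFormA_of_cos_eq_zero ha hb
  · have hb : 1 + 2 * Real.cos y₀ = 0 := by
      by_contra hb
      exact h₁ ⟨ha, hb⟩
    have ha' : 1 + 2 * Real.cos x₀ = 0 := by
      by_contra ha'
      refine h₂ ⟨fun h => ?_, ha'⟩
      rw [h] at hb
      norm_num at hb
    exact hasNormalFormA_of_cos_eq_neg_half ha' hb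

theorem omega_eq (q : Plane) : omega q = 8 - 2 * Real.cos (q 0) - 2 * Real.cos (q 1) -
    4 * Real.cos (q 0) * Real.cos (q 1) := by
  rw [omega, Real.cos_add, Real.cos_sub]
  ring

theorem phase_eq_trigPhase (p : Plane) :
    phase p = fun q => trigPhase (p 0) (p 1) (q 0, q 1) := by
  have h0 : HasFDerivAt (fun q : Plane => Real.cos (q 0))
      (-Real.sin (p 0) • (EuclideanSpace.proj 0 : Plane →L[ℝ] ℝ)) p :=
    (EuclideanSpace.proj 0 : Plane →L[ℝ] ℝ).hasFDerivAt.cos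
  have h1 : HasFDerivAt (fun q : Plane => Real.cos (q 1))
      (-Real.sin (p 1) • (EuclideanSpace.proj 1 : Plane →L[ℝ] ℝ)) p :=
    (EuclideanSpace.proj 1 : Plane →L[ℝ] ℝ).hasFDerivAt.cos
  have hd := (((h0.const_mul 2).const_sub 8).sub (h1.const_mul 2)).sub
    ((h0.const_mul 4).mul h1)
  have hω : omega = fun q : Plane => 8 - 2 * Real.cos (q 0) - 2 * Real.cos (q 1) -
    4 * Real.cos (q 0) * Real.cos (q 1) := funext omega_eq
  ext q
  have hinner : inner ℝ q (gradient omega p) = fderiv ℝ omega p q := by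
    simp [inner_gradient_right]
  have hval : fderiv ℝ omega p q = 2 * Real.sin (p 0) * (1 + 2 * Real.cos (p 1)) * q 0 +
      2 * Real.sin (p 1) * (1 + 2 * Real.cos (p 0)) * q 1 := by
    rw [hω]
    refine (congrArg (fun T : Plane →L[ℝ] ℝ => T q) hd.fderiv).trans ?_
    simp only [sub_apply, add_apply, smul_apply, neg_apply, PiLp.proj_apply, smul_eq_mul]
    ring
  rw [phase, hinner, hval, omega_eq, trigPhase]
  ring

theorem proposition2p3 (p : Plane)
    (hx : p 0 ∈ Set.Icc (0 : ℝ) (2 * Real.pi)) (hy : p 1 ∈ Set.Icc (0 : ℝ) (2 * Real.pi)) :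
    ∃ k : ℕ, 1 ≤ k ∧ k ≤ 3 ∧ HasTypeA k (phase p) p := by
  obtain ⟨k, hk1, hk3, hk⟩ := exists_hasNormalFormA (p 0) (p 1)
  refine ⟨k, hk1, hk3, ?_⟩
  rw [phase_eq_trigPhase]
  exact hk.hasTypeA
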